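/- Let $(\Omega,\mathcal E,P)$ be a complete Rényi space, i.e. $P$ is a $\sigma$-finite measure (representing a full conditional probability space, and determined by it up to a positive factor) such that every subset of a $P$-null set belongs to $\mathcal E$. Let $H$ be a separable complex Hilbert space. A random set in a topological space $Y$ is a map $X$ from $\Omega$ to the subsets of $Y$ that is measurable with respect to the $\sigma$-field generated by the families $\{F\subseteq Y : F\cap U\neq\emptyset\}$, $U\subseteq Y$ open; equivalently, $\{\omega : X(\omega)\cap U\ne\emptyset\}\in\mathcal E$ for every open $U$. A random closed operator in $H$ is a map $T$ assigning to each $\omega\in\Omega$ a closed linear operator $T(\omega):D(T(\omega))\to H$, $D(T(\omega))\subseteq H$ (possibly unbounded and not necessarily densely defined), whose graph is a random set in $H\times H$. Write $\Sigma_p(\omega)$ for the set of eigenvalues of $T(\omega)$ and $\Sigma(\omega)$ for its spectrum, i.e. the set of those $z\in\mathbb C$ for which $T(\omega)-z:D(T(\omega))\to H$ is not a bijection with bounded inverse. 1. $\Sigma_p$ and $\Sigma$ are random sets in $\mathbb C$: for every open $U\subseteq\mathbb C$ the sets $\{\omega:\Sigma_p(\omega)\cap U\neq\emptyset\}$ and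 $\{\omega:\Sigma(\omega)\cap U\neq\emptyset\}$ belong to $\mathcal E$. 2. Let $(\theta_i)_{i\in I}$ be a family of measurable maps $\Omega\to\Omega$ that is metrically transitive: every $A\in\mathcal E$ with $\theta_i^{-1}A=A$ for all $i\in I$ satisfies $P(A)=0$ or $P(\Omega\setminus A)=0$. Suppose that $T$ is unitarily invariant: for all $i\in I$ and $\omega\in\Omega$ there is a unitary $V$ on $H$ with $T(\theta_i\omega)=V\,T(\omega)\,V^{-1}$. Then there are fixed sets $F_p,F\subseteq\mathbb C$ such that $\overline{\Sigma_p(\omega)}=F_p$ and $\Sigma(\omega)=F$ for $P$-almost every $\omega$. The same conclusion holds if both hypotheses are read modulo null sets, i.e. if for each $i\in I$ the unitary invariance holds for $P$-almost every $\omega$, and every $A\in\mathcal E$ with $P(\theta_i^{-1}A\,\triangle\,A)=0$ for all $i\in I$ satisfies $P(A)=0$ or $P(\Omega\setminus A)=0$. -/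

import Mathlib

open MeasureTheory

namespace RandomOperator

/-- The σ-field on the set of all subsets of a topological space that is generated by the families
`{F | F ∩ U ≠ ∅}` with `U` open. -/
abbrev hitMeasurableSpace (Y : Type*) [TopologicalSpace Y] : MeasurableSpace (Set Y) :=
  MeasurableSpace.generateFrom {𝒜 | ∃ U : Set Y, IsOpen U ∧ 𝒜 = {F | (F ∩ U).Nonempty}}

/-- A random set in `Y`: a measurable map from `Ω` into the subsets of `Y`. -/
def IsRandomSet {Ω Y : Type*} [MeasurableSpace Ω] [TopologicalSpace Y] (X : Ω → Set Y) : Prop :=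
  @Measurable Ω (Set Y) _ (hitMeasurableSpace Y) X

/-- `X` is a random set iff `{ω | X ω ∩ U ≠ ∅}` is an event for every open `U`. -/
theorem isRandomSet_iff {Ω Y : Type*} [MeasurableSpace Ω] [TopologicalSpace Y] (X : Ω → Set Y) :
    IsRandomSet X ↔ ∀ U : Set Y, IsOpen U → MeasurableSet {ω | (X ω ∩ U).Nonempty} := by
  constructor
  · intro h U hU
    exact h (MeasurableSpace.measurableSet_generateFrom ⟨U, hU, rfl⟩)
  · intro h
    refine @measurable_generateFrom Ω (Set Y) _ _ X ?_
    rintro _ ⟨U, hU, rfl⟩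
    exact h U hU

section Operators

variable {H : Type*} [NormedAddCommGroup H] [InnerProductSpace ℂ H]

/-- The eigenvalues of a (possibly unbounded, not necessarily densely defined) operator. -/
def eigenvalueSet (T : H →ₗ.[ℂ] H) : Set ℂ :=
  {z | ∃ x : T.domain, (x : H) ≠ 0 ∧ T x = z • (x : H)}

/-- The resolvent set: those `z` for which `T - z : D(T) → H` is a bijection whose inverse `R`
is a bounded operator on all of `H`. -/
def resolventSet (T : H →ₗ.[ℂ] H) : Set ℂ :=
  {z | ∃ R : H →L[ℂ] H,
    (∀ y : H, ∃ h : R y ∈ T.domain, T ⟨R y, h⟩ - z • R y = y) ∧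
    ∀ x : T.domain, R (T x - z • (x : H)) = x}

/-- The spectrum: the complement of the resolvent set. -/
def spectrum (T : H →ₗ.[ℂ] H) : Set ℂ := (resolventSet T)ᶜ

/-- `S = V T V⁻¹` (with `D(S) = V D(T)`) for some unitary `V`, expressed through the graphs. -/
def UnitarilyEquivalent (T S : H →ₗ.[ℂ] H) : Prop :=
  ∃ V : H ≃ₗᵢ[ℂ] H, ∀ x y : H, (x, y) ∈ T.graph ↔ (V x, V y) ∈ S.graph

variable {Ω : Type*} [MeasurableSpace Ω]

/-- A random closed operator: a map into the closed operators whose graph is a random set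
in `H × H`. -/
structure IsRandomClosedOperator (T : Ω → H →ₗ.[ℂ] H) : Prop where
  closed : ∀ ω, (T ω).IsClosed
  random : IsRandomSet (fun ω => ((T ω).graph : Set (H × H)))

/-- Unitary invariance with respect to the transformations `θ i`: for every `i` and `ω` the
operators `T (θ i ω)` and `T ω` are unitarily equivalent. The unitary may depend on `i` and `ω`. -/
def IsUnitarilyInvariant {ι : Type*} (θ : ι → Ω → Ω) (T : Ω → H →ₗ.[ℂ] H) : Prop :=
  ∀ i ω, UnitarilyEquivalent (T ω) (T (θ i ω))

/-- Unitary invariance, with an exceptional null set for each transformation. -/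
def IsUnitarilyInvariantAE (P : Measure Ω) {ι : Type*} (θ : ι → Ω → Ω)
    (T : Ω → H →ₗ.[ℂ] H) : Prop :=
  ∀ i, ∀ᵐ ω ∂P, UnitarilyEquivalent (T ω) (T (θ i ω))

end Operators

/-- A metrically transitive family of measurable transformations: every event that is invariant
under all of them is a null set or the complement of a null set. -/
structure IsMetricallyTransitive {Ω : Type*} [MeasurableSpace Ω] (P : Measure Ω) {ι : Type*}
    (θ : ι → Ω → Ω) : Prop where
  measurable : ∀ i, Measurable (θ i)
  trivial : ∀ A : Set Ω, MeasurableSet A → (∀ i, θ i ⁻¹' A = A) → P A = 0 ∨ P Aᶜ = 0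

/-- Metric transitivity modulo null sets: every event that is, for each transformation, invariant
up to a null set is a null set or the complement of a null set. -/
structure IsMetricallyTransitiveAE {Ω : Type*} [MeasurableSpace Ω] (P : Measure Ω) {ι : Type*}
    (θ : ι → Ω → Ω) : Prop where
  measurable : ∀ i, Measurable (θ i)
  trivial : ∀ A : Set Ω, MeasurableSet A → (∀ i, θ i ⁻¹' A =ᵐ[P] A) → P A = 0 ∨ P Aᶜ = 0

end RandomOperator

/-! Only hits of the graph by open sets are known to be events, so each spectral question is reduced
to countably many such hits. In ℂ it suffices to test with compact `K`. Eigenvalues: eigenvectors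
are normalised by `⟪e, x⟫ = 1` and `‖x‖ ≤ M`, conditions that survive weak limits. Since a closed
subspace is weakly closed, the graph contains such an eigenpair with eigenvalue in `K` iff it meets
every open thickening of the set of these pairs (`inter_eigenpairSet_nonempty`). Spectrum: `K`
avoids it iff one resolvent bound holds on a countable dense subset of `K`
(`subset_resolventSet_iff`). A bound at one point means a lower bound for `T - z` plus dense range
(`hasResolventBound_iff`), both visible through open sets. Both sets are unitary invariants, so
their hitting events are null or conull. A countable base then makes the closures almost surely
constant. -/

namespace RandomOperator

open Filter Topology Set

/-! ### Weak compactness of normalised eigenpairs -/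

section WeakCompactness

variable {H : Type*} [NormedAddCommGroup H] [InnerProductSpace ℂ H]

/-- The pairs `(x, z • x)` with `z ∈ K`, `‖x‖ ≤ M` and `⟪e, x⟫ = 1`. -/
def eigenpairSet (K : Set ℂ) (e : H) (M : ℝ) : Set (H × H) :=
  {p | ∃ z ∈ K, ‖p.1‖ ≤ M ∧ inner ℂ e p.1 = 1 ∧ p.2 = z • p.1}

/-- Bounded sequences in a separable Hilbert space have weakly convergent subsequences. -/
theorem exists_weak_subseq_tendsto [CompleteSpace H] [TopologicalSpace.SeparableSpace H]
    {x : ℕ → H} {M : ℝ} (hx : ∀ k, ‖x k‖ ≤ M) :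
    ∃ (a : H) (φ : ℕ → ℕ), StrictMono φ ∧
      ∀ f : H →L[ℂ] ℂ, Tendsto (fun k => f (x (φ k))) atTop (𝓝 (f a)) := by
  have hmem : ∀ k, StrongDual.toWeakDual (InnerProductSpace.toDual ℂ H (x k)) ∈
      WeakDual.toStrongDual ⁻¹' Metric.closedBall (0 : StrongDual ℂ H) M := by
    intro k
    have : ‖InnerProductSpace.toDual ℂ H (x k)‖ ≤ M := by
      rw [LinearIsometryEquiv.norm_map]; exact hx k
    simpa [mem_closedBall_zero_iff] using this
  obtain ⟨g, -, φ, hφ, hg⟩ := WeakDual.isSeqCompact_closedBall ℂ H 0 M hmem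
  refine ⟨(InnerProductSpace.toDual ℂ H).symm (WeakDual.toStrongDual g), φ, hφ, fun f => ?_⟩
  rw [tendsto_iff_forall_eval_tendsto_topDualPairing] at hg
  have h1 := hg ((InnerProductSpace.toDual ℂ H).symm f)
  have h2 := (Complex.continuous_conj.tendsto _).comp h1
  have hf : ∀ y, f y = (starRingEnd ℂ) (inner ℂ y ((InnerProductSpace.toDual ℂ H).symm f)) := by
    intro y
    rw [inner_conj_symm, InnerProductSpace.toDual_symm_apply]
  rw [hf]
  have h3 : inner ℂ ((InnerProductSpace.toDual ℂ H).symm (WeakDual.toStrongDual g))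
      ((InnerProductSpace.toDual ℂ H).symm f) =
      (topDualPairing ℂ H) g ((InnerProductSpace.toDual ℂ H).symm f) := by
    rw [InnerProductSpace.toDual_symm_apply]; rfl
  rw [h3]
  refine h2.congr fun k => ?_
  rw [hf]; rfl

/-- A closed convex set that meets every thickening of `eigenpairSet K e M`, with `K` compact,
meets `eigenpairSet K e M` itself. -/
theorem inter_eigenpairSet_nonempty [CompleteSpace H] [TopologicalSpace.SeparableSpace H]
    {G : Set (H × H)} (hG : IsClosed G) (hconv : Convex ℝ G) {K : Set ℂ} (hK : IsCompact K)
    (e : H) (M : ℝ)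
    (h : ∀ k : ℕ, (G ∩ Metric.thickening (1 / ((k : ℝ) + 1)) (eigenpairSet K e M)).Nonempty) :
    (G ∩ eigenpairSet K e M).Nonempty := by
  choose g hgG hg using h
  simp only [Metric.mem_thickening_iff] at hg
  choose s hs hgs using hg
  choose z hzK hsM hse hsz using hs
  obtain ⟨w, hwK, φ, hφ, hw⟩ := hK.tendsto_subseq hzK
  obtain ⟨a, ψ, hψ, ha⟩ := exists_weak_subseq_tendsto (x := fun k => (s (φ k)).1)
    (fun k => hsM (φ k))
  have hw' : Tendsto (fun k => z (φ (ψ k))) atTop (𝓝 w) := hw.comp hψ.tendsto_atTop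
  -- The scalars converge and the vectors converge weakly, so their products converge weakly.
  have hweak : ∀ f : (H × H) →L[ℂ] ℂ,
      Tendsto (fun k => f (s (φ (ψ k)))) atTop (𝓝 (f (a, w • a))) := by
    intro f
    have h1 := ha (f.comp (ContinuousLinearMap.inl ℂ H H))
    have h2 := ha (f.comp (ContinuousLinearMap.inr ℂ H H))
    have key : ∀ (y : H) (c : ℂ), f (y, c • y) =
        f.comp (ContinuousLinearMap.inl ℂ H H) y +
          c * f.comp (ContinuousLinearMap.inr ℂ H H) y := by
      intro y c
      have : ((y, c • y) : H × H) = (y, 0) + c • ((0, y) : H × H) := by simp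
      rw [this, map_add, map_smul]
      rfl
    rw [key]
    refine (h1.add (hw'.mul h2)).congr fun k => ?_
    have hk : s (φ (ψ k)) = ((s (φ (ψ k))).1, z (φ (ψ k)) • (s (φ (ψ k))).1) :=
      Prod.ext rfl (hsz _)
    rw [hk, key]
  have hmono : Tendsto (fun k => φ (ψ k)) atTop atTop :=
    hφ.tendsto_atTop.comp hψ.tendsto_atTop
  have hdiff : Tendsto (fun k => g (φ (ψ k)) - s (φ (ψ k))) atTop (𝓝 0) := by
    have : Tendsto (fun k => g k - s k) atTop (𝓝 0) := by
      refine squeeze_zero_norm (fun k => ?_) tendsto_one_div_add_atTop_nhds_zero_nat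
      rw [← dist_eq_norm]
      exact (hgs k).le
    exact this.comp hmono
  refine ⟨(a, w • a), ?_, w, hwK, ?_, ?_, rfl⟩
  -- A functional separating the limit from `G` contradicts weak convergence: the points of `G`
  -- differ from the eigenpairs by a norm-null sequence.
  · by_contra hmem
    obtain ⟨f, u, hfu, huf⟩ := RCLike.geometric_hahn_banach_closed_point (𝕜 := ℂ) hconv hG hmem
    have h1 : Tendsto (fun k => f (g (φ (ψ k)))) atTop (𝓝 (f (a, w • a))) := by
      have := ((f.continuous.tendsto 0).comp hdiff).add (hweak f)
      simpa using this
    have h2 := (Complex.continuous_re.tendsto _).comp h1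
    have h3 : (f (a, w • a)).re ≤ u := le_of_tendsto h2 (Eventually.of_forall fun k =>
      (hfu _ (hgG _)).le)
    exact absurd huf (not_lt.mpr h3)
  · by_cases ha0 : a = 0
    · simpa [ha0] using (norm_nonneg _).trans (hsM 0)
    -- Testing against `a` itself gives `‖a‖² ≤ ‖a‖ M`.
    · have h1 := (ha (innerSL ℂ a)).norm
      have h2 : ‖innerSL ℂ a a‖ ≤ ‖a‖ * M := by
        refine le_of_tendsto h1 (Eventually.of_forall fun k => ?_)
        rw [innerSL_apply_apply]
        exact (norm_inner_le_norm _ _).trans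
          (mul_le_mul_of_nonneg_left (hsM _) (norm_nonneg _))
      rw [innerSL_apply_apply, inner_self_eq_norm_sq_to_K] at h2
      have h3 : ‖a‖ * ‖a‖ ≤ ‖a‖ * M := by simpa [sq] using h2
      exact le_of_mul_le_mul_left h3 (norm_pos_iff.mpr ha0)
  · have h1 := ha (innerSL ℂ e)
    simp only [innerSL_apply_apply, hse] at h1
    exact tendsto_nhds_unique h1 tendsto_const_nhds

end WeakCompactness

/-! ### Measurability of eigenvalues and spectrum -/

section Measurability

variable {Ω : Type*} [MeasurableSpace Ω]

/-- To check that `X` is a random set in a locally compact second countable space, it suffices to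
consider compact test sets. -/
theorem IsRandomSet.of_isCompact {Y : Type*} [TopologicalSpace Y] [LocallyCompactSpace Y]
    [SecondCountableTopology Y] {X : Ω → Set Y}
    (h : ∀ K : Set Y, IsCompact K → MeasurableSet {ω | (X ω ∩ K).Nonempty}) : IsRandomSet X := by
  rw [isRandomSet_iff]
  intro U hU
  have hnhds : ∀ y ∈ U, ∃ K, IsCompact K ∧ y ∈ interior K ∧ K ⊆ U := fun y hy =>
    exists_compact_subset hU hy
  choose! K hKc hKi hKU using hnhds
  obtain ⟨t, htU, htc, ht⟩ := TopologicalSpace.countable_cover_nhdsWithin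
    (f := fun y => interior (K y)) (s := U)
    (fun y hy => mem_nhdsWithin_of_mem_nhds (isOpen_interior.mem_nhds (hKi y hy)))
  have : {ω | (X ω ∩ U).Nonempty} = ⋃ y ∈ t, {ω | (X ω ∩ K y).Nonempty} := by
    ext ω
    simp only [mem_ofPred_eq, mem_iUnion, exists_prop]
    constructor
    · rintro ⟨y, hyX, hyU⟩
      obtain ⟨c, hc, hyc⟩ := mem_iUnion₂.mp (ht hyU)
      exact ⟨c, hc, y, hyX, interior_subset hyc⟩
    · rintro ⟨c, hc, y, hyX, hyK⟩
      exact ⟨y, hyX, hKU c (htU hc) hyK⟩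
  rw [this]
  exact MeasurableSet.biUnion htc fun y hy => h _ (hKc y (htU hy))

variable {H : Type*} [NormedAddCommGroup H] [InnerProductSpace ℂ H]

/-- A nonzero vector is not orthogonal to a whole dense sequence, so it can be rescaled to have
inner product 1 with some term. Unlike `‖x‖ = 1`, this excludes 0 even after a weak limit. -/
theorem eigenvalueSet_inter_nonempty_iff [TopologicalSpace.SeparableSpace H]
    (T : H →ₗ.[ℂ] H) (K : Set ℂ) :
    (eigenvalueSet T ∩ K).Nonempty ↔ ∃ n M : ℕ,
      ((T.graph : Set (H × H)) ∩
        eigenpairSet K (TopologicalSpace.denseSeq H n) M).Nonempty := by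
  constructor
  · rintro ⟨z, ⟨x, hx0, hx⟩, hzK⟩
    obtain ⟨n, hn⟩ : ∃ n, inner ℂ (TopologicalSpace.denseSeq H n) (x : H) ≠ 0 := by
      by_contra! hcon
      exact hx0 ((TopologicalSpace.denseRange_denseSeq H).eq_zero_of_inner_right ℂ hcon)
    set c := (inner ℂ (TopologicalSpace.denseSeq H n) (x : H))⁻¹ with hc
    obtain ⟨M, hM⟩ := exists_nat_ge ‖c • (x : H)‖
    refine ⟨n, M, (c • (x : H), c • T x), ?_, z, hzK, hM, ?_, ?_⟩
    · exact T.graph.smul_mem c (T.mem_graph x)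
    · simp only [inner_smul_right, hc]
      exact inv_mul_cancel₀ hn
    · simp only [hx]
      exact smul_comm _ _ _
  · rintro ⟨n, M, ⟨x, y⟩, hG, z, hzK, -, hx, hy⟩
    simp only at hx hy
    obtain ⟨x', rfl, hx'⟩ := (LinearPMap.mem_graph_iff _).mp hG
    refine ⟨z, ⟨x', ?_, hx'.trans hy⟩, hzK⟩
    intro h0
    rw [h0, inner_zero_right] at hx
    exact zero_ne_one hx

theorem IsRandomClosedOperator.measurableSet_hit {T : Ω → H →ₗ.[ℂ] H}
    (hT : IsRandomClosedOperator T) {U : Set (H × H)} (hU : IsOpen U) :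
    MeasurableSet {ω | (((T ω).graph : Set (H × H)) ∩ U).Nonempty} :=
  (isRandomSet_iff _).mp hT.random U hU

theorem IsRandomClosedOperator.isRandomSet_eigenvalueSet [CompleteSpace H]
    [TopologicalSpace.SeparableSpace H] {T : Ω → H →ₗ.[ℂ] H} (hT : IsRandomClosedOperator T) :
    IsRandomSet fun ω => eigenvalueSet (T ω) := by
  refine IsRandomSet.of_isCompact fun K hK => ?_
  have : {ω | (eigenvalueSet (T ω) ∩ K).Nonempty} = ⋃ (n : ℕ) (M : ℕ), ⋂ k : ℕ,
      {ω | (((T ω).graph : Set (H × H)) ∩ Metric.thickening (1 / ((k : ℝ) + 1))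
        (eigenpairSet K (TopologicalSpace.denseSeq H n) M)).Nonempty} := by
    ext ω
    simp only [mem_ofPred_eq, mem_iUnion, mem_iInter, eigenvalueSet_inter_nonempty_iff]
    refine exists_congr fun n => exists_congr fun M => ⟨fun h k => ?_, fun h => ?_⟩
    · exact h.mono (inter_subset_inter_right _ (Metric.self_subset_thickening (by positivity) _))
    · exact inter_eigenpairSet_nonempty (hT.closed ω)
        (((T ω).graph.restrictScalars ℝ).convex) hK _ _ h
  rw [this]
  exact MeasurableSet.iUnion fun n => MeasurableSet.iUnion fun M => MeasurableSet.iInter fun k =>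
    hT.measurableSet_hit Metric.isOpen_thickening

/-- `z` belongs to the resolvent set and `T - z` is bounded below by `1 / M`. -/
def HasResolventBound (T : H →ₗ.[ℂ] H) (M : ℝ) (z : ℂ) : Prop :=
  z ∈ resolventSet T ∧ ∀ p ∈ T.graph, ‖p.1‖ ≤ M * ‖p.2 - z • p.1‖

theorem HasResolventBound.mono {T : H →ₗ.[ℂ] H} {M N : ℝ} {z : ℂ} (h : HasResolventBound T M z)
    (hMN : M ≤ N) : HasResolventBound T N z :=
  ⟨h.1, fun p hp => (h.2 p hp).trans (mul_le_mul_of_nonneg_right hMN (norm_nonneg _))⟩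

theorem exists_hasResolventBound {T : H →ₗ.[ℂ] H} {z : ℂ} (hz : z ∈ resolventSet T) :
    ∃ M : ℕ, HasResolventBound T M z := by
  obtain ⟨R, hR1, hR2⟩ := id hz
  obtain ⟨M, hM⟩ := exists_nat_ge ‖R‖
  refine ⟨M, hz, ?_⟩
  rintro ⟨x, y⟩ hp
  obtain ⟨x', rfl, rfl⟩ := (LinearPMap.mem_graph_iff _).mp hp
  calc ‖(x' : H)‖ = ‖R (T x' - z • (x' : H))‖ := by rw [hR2]
    _ ≤ ‖R‖ * ‖T x' - z • (x' : H)‖ := R.le_opNorm _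
    _ ≤ M * ‖T x' - z • (x' : H)‖ := by gcongr

/-- The graph is complete, so a map on it that is bounded below has closed range; density then gives
surjectivity. The resolvent is the inverse followed by the first projection. -/
theorem hasResolventBound_iff [CompleteSpace H] {T : H →ₗ.[ℂ] H} (hT : T.IsClosed) {M : ℝ}
    (hM : 0 ≤ M) {z : ℂ} :
    HasResolventBound T M z ↔ (∀ p ∈ T.graph, ‖p.1‖ ≤ M * ‖p.2 - z • p.1‖) ∧
      Dense ((fun p : H × H => p.2 - z • p.1) '' T.graph) := by
  constructor
  · rintro ⟨⟨R, hR1, hR2⟩, h⟩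
    refine ⟨h, fun y => subset_closure ?_⟩
    obtain ⟨hy, hy'⟩ := hR1 y
    exact ⟨(R y, T ⟨R y, hy⟩), T.mem_graph ⟨R y, hy⟩, hy'⟩
  · rintro ⟨h, hd⟩
    refine ⟨?_, h⟩
    let L : T.graph →L[ℂ] H := (ContinuousLinearMap.snd ℂ H H -
      z • ContinuousLinearMap.fst ℂ H H).comp T.graph.subtypeL
    have hL : ∀ p : T.graph, L p = (p : H × H).2 - z • (p : H × H).1 := fun p => rfl
    have hcomplete : CompleteSpace T.graph := hT.completeSpace_coe
    -- `M` bounds the first component and `1 + ‖z‖ * M` the second; the sum bounds their maximum.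
    have hbound : ∀ p : T.graph, ‖p‖ ≤ (M + 1 + ‖z‖ * M : ℝ) * ‖L p‖ := by
      intro p
      have h1 := h p p.2
      rw [← hL] at h1
      have h2 : ‖(p : H × H).2‖ ≤ ‖L p‖ + ‖z‖ * ‖(p : H × H).1‖ := by
        have : (p : H × H).2 = L p + z • (p : H × H).1 := by rw [hL]; abel
        rw [this, ← norm_smul]
        exact norm_add_le _ _
      have h3 : ‖z‖ * ‖(p : H × H).1‖ ≤ ‖z‖ * (M * ‖L p‖) := by gcongr
      have h4 : 0 ≤ M * ‖L p‖ := by positivity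
      have h5 : 0 ≤ ‖z‖ * (M * ‖L p‖) := by positivity
      have h6 := norm_nonneg (L p)
      rw [Submodule.coe_norm, Prod.norm_def]
      exact max_le (by linarith) (by linarith)
    have hanti : AntilipschitzWith (M + 1 + ‖z‖ * M).toNNReal L := by
      refine L.antilipschitz_of_bound fun p => ?_
      rw [Real.coe_toNNReal _ (by positivity)]
      exact hbound p
    have hrange : L.range = ⊤ := by
      have hcl : IsClosed (Set.range L) := hanti.isClosed_range L.uniformContinuous
      have hr : Set.range L = (fun p : H × H => p.2 - z • p.1) '' T.graph := by
        ext y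
        simp [hL]
      rw [← hr] at hd
      rw [LinearMap.range_eq_top]
      exact Set.range_eq_univ.mp (hcl.closure_eq ▸ hd.closure_eq)
    let e := ContinuousLinearEquiv.ofBijective L (LinearMap.ker_eq_bot.mpr hanti.injective) hrange
    have he : ∀ p, e p = L p := fun p => rfl
    refine ⟨(ContinuousLinearMap.fst ℂ H H).comp (T.graph.subtypeL.comp (e.symm : H →L[ℂ] T.graph)), ?_, ?_⟩
    · intro y
      obtain ⟨x, hx1, hx2⟩ := (LinearPMap.mem_graph_iff' T).mp (e.symm y).2 |>.imp fun x hx =>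
        Prod.ext_iff.mp hx
      have hy : L (e.symm y) = y := e.apply_symm_apply y
      have hfst : ((ContinuousLinearMap.fst ℂ H H).comp (T.graph.subtypeL.comp
        (e.symm : H →L[ℂ] T.graph))) y = ((e.symm y : T.graph) : H × H).1 := rfl
      simp only at hx1 hx2
      rw [hfst, ← hx1]
      refine ⟨x.2, ?_⟩
      rw [Subtype.coe_eta, hx1, hx2, ← hL, hy]
    · intro x
      have : e.symm (T x - z • (x : H)) = ⟨(x, T x), T.mem_graph x⟩ := by
        rw [ContinuousLinearEquiv.symm_apply_eq]
        rfl
      change ((e.symm (T x - z • (x : H)) : T.graph) : H × H).1 = x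
      rw [this]

/-- Neumann series: `T - w = (1 - (w - z) R)(T - z)`, so the resolvent at `w` is `R (1 - (w - z)
R)⁻¹`. Absorbing `‖x‖ / 2` in the lower bound doubles `M`. -/
theorem HasResolventBound.of_norm_sub_mul_le [CompleteSpace H] {T : H →ₗ.[ℂ] H} {M : ℝ}
    (hM : 0 ≤ M) {z w : ℂ} (hz : HasResolventBound T M z) (hw : ‖w - z‖ * M ≤ 1 / 2) :
    HasResolventBound T (2 * M) w := by
  obtain ⟨⟨R, hR1, hR2⟩, h⟩ := hz
  refine ⟨?_, ?_⟩
  · have hR : ‖R‖ ≤ M := by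
      refine R.opNorm_le_bound hM fun y => ?_
      obtain ⟨hy, hy'⟩ := hR1 y
      have := h _ (T.mem_graph ⟨R y, hy⟩)
      simp only at this
      rwa [hy'] at this
    have hA : ‖(w - z) • R‖ < 1 := by
      rw [norm_smul]
      calc ‖w - z‖ * ‖R‖ ≤ ‖w - z‖ * M := by gcongr
        _ < 1 := by linarith
    obtain ⟨u, hu⟩ := isUnit_one_sub_of_norm_lt_one hA
    have hu1 : ∀ y, ((u⁻¹ : (H →L[ℂ] H)ˣ) : H →L[ℂ] H) y -
        (w - z) • R (((u⁻¹ : (H →L[ℂ] H)ˣ) : H →L[ℂ] H) y) = y := by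
      intro y
      have : ((u : H →L[ℂ] H) * ((u⁻¹ : (H →L[ℂ] H)ˣ) : H →L[ℂ] H)) y = y := by
        rw [u.mul_inv]; rfl
      rw [hu] at this
      exact this
    have hu2 : ∀ y, ((u⁻¹ : (H →L[ℂ] H)ˣ) : H →L[ℂ] H) (y - (w - z) • R y) = y := by
      intro y
      have : (((u⁻¹ : (H →L[ℂ] H)ˣ) : H →L[ℂ] H) * (u : H →L[ℂ] H)) y = y := by
        rw [u.inv_mul]; rfl
      rw [hu] at this
      exact this
    have hcomm : ∀ y, R (((u⁻¹ : (H →L[ℂ] H)ˣ) : H →L[ℂ] H) (y - (w - z) • R y)) = R y :=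
      fun y => by rw [hu2]
    refine ⟨R.comp ((u⁻¹ : (H →L[ℂ] H)ˣ) : H →L[ℂ] H), ?_, ?_⟩
    · intro y
      obtain ⟨hy, hy'⟩ := hR1 (((u⁻¹ : (H →L[ℂ] H)ˣ) : H →L[ℂ] H) y)
      refine ⟨hy, ?_⟩
      have h1 := hu1 y
      simp only [ContinuousLinearMap.comp_apply]
      rw [sub_smul] at h1
      rw [sub_eq_iff_eq_add] at hy'
      rw [hy']
      refine Eq.trans ?_ h1
      abel
    · intro x
      have h1 := hR2 x
      have h2 := hcomm (T x - z • (x : H))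
      rw [h1] at h2
      rw [ContinuousLinearMap.comp_apply]
      convert! h2 using 3
      rw [sub_smul]
      abel
  · intro p hp
    have h1 := h p hp
    have h2 : ‖p.2 - z • p.1‖ ≤ ‖p.2 - w • p.1‖ + ‖w - z‖ * ‖p.1‖ := by
      rw [← norm_smul]
      refine le_of_eq_of_le ?_ (norm_add_le _ _)
      rw [sub_smul]
      congr 1
      abel
    have h3 : M * ‖p.2 - z • p.1‖ ≤ M * (‖p.2 - w • p.1‖ + ‖w - z‖ * ‖p.1‖) := by gcongr
    have h4 : ‖w - z‖ * M * ‖p.1‖ ≤ 1 / 2 * ‖p.1‖ := by gcongr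
    nlinarith

/-- On a compact subset of the resolvent set the resolvent is uniformly bounded, and conversely it
is enough to have a uniform bound on a dense subset. -/
theorem subset_resolventSet_iff [CompleteSpace H] (T : H →ₗ.[ℂ] H) {K D : Set ℂ}
    (hK : IsCompact K) (hDK : D ⊆ K) (hD : K ⊆ closure D) :
    K ⊆ resolventSet T ↔ ∃ M : ℕ, ∀ z ∈ D, HasResolventBound T M z := by
  constructor
  · intro h
    let O : ℕ → Set ℂ := fun M => interior {z | HasResolventBound T M z}
    have hO : Monotone O := fun M N hMN => interior_mono fun z (hz : HasResolventBound T M z) =>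
      hz.mono (by exact_mod_cast hMN)
    have hcover : K ⊆ ⋃ M, O M := by
      intro z hz
      obtain ⟨m, hm⟩ := exists_hasResolventBound (h hz)
      refine mem_iUnion.mpr ⟨2 * m, mem_interior_iff_mem_nhds.mpr ?_⟩
      have hpos : (0 : ℝ) < 1 / (2 * (m + 1)) := by positivity
      filter_upwards [Metric.ball_mem_nhds z hpos] with w hw
      rw [Metric.mem_ball, dist_eq_norm, lt_div_iff₀ (by positivity)] at hw
      have : HasResolventBound T (2 * (m : ℝ)) w := by
        refine hm.of_norm_sub_mul_le m.cast_nonneg ?_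
        nlinarith [norm_nonneg (w - z)]
      simpa using this
    obtain ⟨M, hM⟩ := hK.elim_directed_cover O (fun _ => isOpen_interior) hcover
      hO.directed_le
    exact ⟨M, fun z hz => (interior_subset : O M ⊆ {z | HasResolventBound T M z}) (hM (hDK hz))⟩
  · rintro ⟨M, hM⟩ z hz
    -- The radius depends only on `M`, so the balls around points of `D` cover `K`.
    have hpos : (0 : ℝ) < 1 / (2 * (M + 1)) := by positivity
    obtain ⟨d, hd, hzd⟩ := Metric.mem_closure_iff.mp (hD hz) _ hpos
    rw [dist_eq_norm, lt_div_iff₀ (by positivity)] at hzd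
    refine ((hM d hd).of_norm_sub_mul_le M.cast_nonneg ?_).1
    nlinarith [norm_nonneg (z - d)]

theorem IsRandomClosedOperator.measurableSet_hasResolventBound [CompleteSpace H]
    [TopologicalSpace.SeparableSpace H] {T : Ω → H →ₗ.[ℂ] H} (hT : IsRandomClosedOperator T)
    {M : ℝ} (hM : 0 ≤ M) (z : ℂ) : MeasurableSet {ω | HasResolventBound (T ω) M z} := by
  obtain ⟨B, hBc, -, hB⟩ := TopologicalSpace.exists_countable_basis H
  have hcont : Continuous fun p : H × H => p.2 - z • p.1 := by fun_prop
  -- Violating the lower bound is a hit of an open set; dense range means hitting the preimage of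
  -- each nonempty basic open set.
  have : {ω | HasResolventBound (T ω) M z} =
      {ω | (((T ω).graph : Set (H × H)) ∩ {p | M * ‖p.2 - z • p.1‖ < ‖p.1‖}).Nonempty}ᶜ ∩
      ⋂ V ∈ B, {ω | V.Nonempty → (((T ω).graph : Set (H × H)) ∩
        (fun p : H × H => p.2 - z • p.1) ⁻¹' V).Nonempty} := by
    ext ω
    rw [mem_ofPred_eq, hasResolventBound_iff (hT.closed ω) hM, hB.dense_iff]
    simp only [mem_inter_iff, mem_compl_iff, mem_ofPred_eq, mem_iInter, Set.not_nonempty_iff_eq_empty,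
      Set.eq_empty_iff_forall_notMem, not_and, not_lt, SetLike.mem_coe]
    refine and_congr_right fun _ => forall₂_congr fun V _ => forall_congr' fun _ => ?_
    rw [Set.inter_comm, ← Set.image_inter_nonempty_iff]
  rw [this]
  refine ((hT.measurableSet_hit (isOpen_lt (by fun_prop) (by fun_prop))).compl).inter
    (MeasurableSet.biInter hBc fun V hV => ?_)
  by_cases hne : V.Nonempty
  · simp only [hne, forall_const]
    exact hT.measurableSet_hit ((hB.isOpen hV).preimage hcont)
  · simp [hne]

theorem IsRandomClosedOperator.isRandomSet_spectrum [CompleteSpace H]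
    [TopologicalSpace.SeparableSpace H] {T : Ω → H →ₗ.[ℂ] H} (hT : IsRandomClosedOperator T) :
    IsRandomSet fun ω => spectrum (T ω) := by
  refine IsRandomSet.of_isCompact fun K hK => ?_
  obtain ⟨D, hDK, hDc, hD⟩ :=
    (TopologicalSpace.IsSeparable.of_separableSpace K).exists_countable_dense_subset
  have : {ω | (spectrum (T ω) ∩ K).Nonempty} =
      (⋃ M : ℕ, ⋂ z ∈ D, {ω | HasResolventBound (T ω) M z})ᶜ := by
    ext ω
    rw [mem_ofPred_eq, mem_compl_iff, ← not_iff_not, not_not, Set.not_nonempty_iff_eq_empty,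
      ← Set.disjoint_iff_inter_eq_empty, spectrum, Set.disjoint_compl_left_iff_subset,
      subset_resolventSet_iff (T ω) hK hDK hD]
    simp
  rw [this]
  exact (MeasurableSet.iUnion fun M => MeasurableSet.biInter hDc fun z _ =>
    hT.measurableSet_hasResolventBound M.cast_nonneg z).compl

end Measurability

/-! ### Unitary invariance, and closedness of the spectrum -/

section Invariance

variable {H : Type*} [NormedAddCommGroup H] [InnerProductSpace ℂ H]

theorem isClosed_spectrum [CompleteSpace H] (T : H →ₗ.[ℂ] H) : IsClosed (spectrum T) := by
  rw [spectrum, isClosed_compl_iff, Metric.isOpen_iff]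
  intro z hz
  obtain ⟨m, hm⟩ := exists_hasResolventBound hz
  refine ⟨1 / (2 * (m + 1)), by positivity, fun w hw => ?_⟩
  rw [Metric.mem_ball, dist_eq_norm, lt_div_iff₀ (by positivity)] at hw
  refine (hm.of_norm_sub_mul_le m.cast_nonneg ?_).1
  nlinarith [norm_nonneg (w - z)]

theorem UnitarilyEquivalent.symm {T S : H →ₗ.[ℂ] H} (h : UnitarilyEquivalent T S) :
    UnitarilyEquivalent S T := by
  obtain ⟨V, hV⟩ := h
  exact ⟨V.symm, fun x y => by simp [hV]⟩

theorem UnitarilyEquivalent.eigenvalueSet_subset {T S : H →ₗ.[ℂ] H}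
    (h : UnitarilyEquivalent T S) : eigenvalueSet T ⊆ eigenvalueSet S := by
  obtain ⟨V, hV⟩ := h
  rintro z ⟨x, hx0, hx⟩
  obtain ⟨x', hx', hTx'⟩ := (LinearPMap.mem_graph_iff S).mp ((hV _ _).mp (T.mem_graph x))
  refine ⟨x', ?_, ?_⟩
  · simpa [hx'] using hx0
  · rw [hTx', hx', hx, map_smul]

theorem UnitarilyEquivalent.resolventSet_subset {T S : H →ₗ.[ℂ] H}
    (h : UnitarilyEquivalent T S) : resolventSet T ⊆ resolventSet S := by
  obtain ⟨V, hV⟩ := h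
  rintro z ⟨R, hR1, hR2⟩
  refine ⟨(V : H →L[ℂ] H).comp (R.comp (V.symm : H →L[ℂ] H)), ?_, ?_⟩
  · intro y
    obtain ⟨hy, hy'⟩ := hR1 (V.symm y)
    obtain ⟨x, hx, hSx⟩ := (LinearPMap.mem_graph_iff S).mp
      ((hV _ _).mp (T.mem_graph ⟨R (V.symm y), hy⟩))
    change ∃ h : V (R (V.symm y)) ∈ S.domain, S ⟨V (R (V.symm y)), h⟩ - z • V (R (V.symm y)) = y
    simp only at hx
    rw [← hx]
    refine ⟨x.2, ?_⟩
    rw [Subtype.coe_eta, hSx, hx, ← map_smul, ← map_sub, hy', V.apply_symm_apply]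
  · intro x
    have hx : (V.symm x, V.symm (S x)) ∈ T.graph := by
      rw [hV]
      simp
    obtain ⟨x', hx', hTx'⟩ := (LinearPMap.mem_graph_iff T).mp hx
    change V (R (V.symm (S x - z • (x : H)))) = x
    have := hR2 x'
    simp only at hx' hTx'
    rw [hTx', hx', ← map_smul, ← map_sub] at this
    rw [this, V.apply_symm_apply]

theorem UnitarilyEquivalent.eigenvalueSet_eq {T S : H →ₗ.[ℂ] H}
    (h : UnitarilyEquivalent T S) : eigenvalueSet T = eigenvalueSet S :=
  h.eigenvalueSet_subset.antisymm h.symm.eigenvalueSet_subset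

theorem UnitarilyEquivalent.spectrum_eq {T S : H →ₗ.[ℂ] H}
    (h : UnitarilyEquivalent T S) : spectrum T = spectrum S :=
  congrArg (·ᶜ) (h.resolventSet_subset.antisymm h.symm.resolventSet_subset)

end Invariance

/-! ### Zero-one law for random sets -/

section ZeroOne

variable {Ω : Type*} [MeasurableSpace Ω] {P : Measure Ω}

/-- If each event `{X ∩ U ≠ ∅}`, `U` open, is null or conull, then `closure X` is almost surely
constant. -/
theorem exists_ae_closure_eq_of_zero_one {Y : Type*} [TopologicalSpace Y]
    [SecondCountableTopology Y] {X : Ω → Set Y}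
    (h : ∀ U : Set Y, IsOpen U → P {ω | (X ω ∩ U).Nonempty} = 0 ∨
      P {ω | (X ω ∩ U).Nonempty}ᶜ = 0) :
    ∃ F : Set Y, ∀ᵐ ω ∂P, closure (X ω) = F := by
  obtain ⟨B, hBc, -, hB⟩ := TopologicalSpace.exists_countable_basis Y
  have key : ∀ᵐ ω ∂P, ∀ U ∈ B, ((X ω ∩ U).Nonempty ↔ ∀ᵐ ω' ∂P, (X ω' ∩ U).Nonempty) := by
    rw [ae_ball_iff hBc]
    intro U hU
    by_cases hQ : ∀ᵐ ω' ∂P, (X ω' ∩ U).Nonempty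
    · filter_upwards [hQ] with ω hω
      exact iff_of_true hω hQ
    · have h0 : ∀ᵐ ω ∂P, ¬ (X ω ∩ U).Nonempty := by
        rcases h U (hB.isOpen hU) with h0 | h1
        · exact measure_eq_zero_iff_ae_notMem.mp h0
        · exact absurd h1 hQ
      filter_upwards [h0] with ω hω
      exact iff_of_false hω hQ
  -- The constant set consists of the points all of whose basic neighbourhoods are hit almost
  -- surely; countability of `B` leaves a single exceptional null set.
  refine ⟨{y | ∀ U ∈ B, y ∈ U → ∀ᵐ ω ∂P, (X ω ∩ U).Nonempty}, ?_⟩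
  filter_upwards [key] with ω hω
  ext y
  rw [hB.mem_closure_iff]
  refine forall₂_congr fun U hU => forall_congr' fun _ => ?_
  rw [Set.inter_comm, hω U hU]

/-- A random set that is invariant under a metrically transitive family has almost surely constant
closure; both hypotheses may be read modulo null sets. -/
theorem IsRandomSet.exists_ae_closure_eq {Y ι : Type*} [TopologicalSpace Y]
    [SecondCountableTopology Y] {X : Ω → Set Y} (hX : IsRandomSet X) {θ : ι → Ω → Ω}
    (h : (IsMetricallyTransitive P θ ∧ ∀ i ω, X (θ i ω) = X ω) ∨
      (IsMetricallyTransitiveAE P θ ∧ ∀ i, ∀ᵐ ω ∂P, X (θ i ω) = X ω)) :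
    ∃ F : Set Y, ∀ᵐ ω ∂P, closure (X ω) = F := by
  refine exists_ae_closure_eq_of_zero_one fun U hU => ?_
  have hmeas := (isRandomSet_iff X).mp hX U hU
  rcases h with ⟨hθ, hinv⟩ | ⟨hθ, hinv⟩
  · refine hθ.trivial _ hmeas fun i => ?_
    ext ω
    simp [hinv i ω]
  · refine hθ.trivial _ hmeas fun i => ?_
    filter_upwards [hinv i] with ω hω
    change ((X (θ i ω) ∩ U).Nonempty) = ((X ω ∩ U).Nonempty)
    rw [hω]

end ZeroOne

end RandomOperator

theorem theorem1 {Ω : Type*} [MeasurableSpace Ω] (P : Measure Ω) [SigmaFinite P] [P.IsComplete]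
    {H : Type*} [NormedAddCommGroup H] [InnerProductSpace ℂ H] [CompleteSpace H]
    [TopologicalSpace.SeparableSpace H]
    (T : Ω → H →ₗ.[ℂ] H) (hT : RandomOperator.IsRandomClosedOperator T) :
    RandomOperator.IsRandomSet (fun ω => RandomOperator.eigenvalueSet (T ω)) ∧
    RandomOperator.IsRandomSet (fun ω => RandomOperator.spectrum (T ω)) ∧
    ∀ (ι : Type*) (θ : ι → Ω → Ω),
      ((RandomOperator.IsMetricallyTransitive P θ ∧
          RandomOperator.IsUnitarilyInvariant θ T) ∨
        (RandomOperator.IsMetricallyTransitiveAE P θ ∧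
          RandomOperator.IsUnitarilyInvariantAE P θ T)) →
      (∃ F : Set ℂ, ∀ᵐ ω ∂P, closure (RandomOperator.eigenvalueSet (T ω)) = F) ∧
      (∃ F : Set ℂ, ∀ᵐ ω ∂P, RandomOperator.spectrum (T ω) = F) := by
  refine ⟨hT.isRandomSet_eigenvalueSet, hT.isRandomSet_spectrum, fun ι θ h => ⟨?_, ?_⟩⟩
  · exact hT.isRandomSet_eigenvalueSet.exists_ae_closure_eq <| h.imp
      (fun h => ⟨h.1, fun i ω => (h.2 i ω).eigenvalueSet_eq.symm⟩)
      (fun h => ⟨h.1, fun i => (h.2 i).mono fun ω hω => hω.eigenvalueSet_eq.symm⟩)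
  · obtain ⟨F, hF⟩ := hT.isRandomSet_spectrum.exists_ae_closure_eq <| h.imp
      (fun h => ⟨h.1, fun i ω => (h.2 i ω).spectrum_eq.symm⟩)
      (fun h => ⟨h.1, fun i => (h.2 i).mono fun ω hω => hω.spectrum_eq.symm⟩)
    exact ⟨F, hF.mono fun ω hω => (RandomOperator.isClosed_spectrum (T ω)).closure_eq.symm.trans hω⟩
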